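/- Let $Q \subset \mathbb{Z}^4$ be a set with the following two properties. (1) Every $x \in Q$ is of the form $x = (m, km, lm, klm)$ for some $k, l, m \in \mathbb{Z}$. (2) For every finite set $F \subset \mathbb{Z}^2$ there is a nonzero integer $m$ such that $(m, km, lm, klm) \in Q$ for all $(k,l) \in F$. Then the first-order theory of the structure $(\mathbb{Z}; +, 1, Q)$ is undecidable. That is, for the first-order language with equality whose non-logical symbols are a binary function symbol $+$, a constant symbol $1$ and a quaternary relation symbol $Q$, interpreted in $\mathbb{Z}$ as addition, the integer $1$ and the given set $Q$, the set of Gödel numbers of sentences that are true in $(\mathbb{Z}; +, 1, Q)$ is not computable. -/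

import Mathlib

namespace PresburgerQ

open FirstOrder

/-- The function symbols `1` (a constant) and `+` (binary). -/
inductive Func : ℕ → Type
  | one : Func 0
  | add : Func 2

/-- The only relation symbol besides equality: the quaternary symbol `Q`. -/
inductive Rel : ℕ → Type
  | quad : Rel 4

/-- The first-order language with signature `(+, 1, Q)`. -/
def lang : Language :=
  { Functions := Func
    Relations := Rel }

/-- The structure `(ℤ; +, 1, Q)`. -/
@[reducible]
def intStructure (Q : Set (ℤ × ℤ × ℤ × ℤ)) : lang.Structure ℤ where
  funMap
    | .one, _ => 1
    | .add, v => v 0 + v 1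
  RelMap
    | .quad, v => (v 0, v 1, v 2, v 3) ∈ Q

/-- The first-order theory of `(ℤ; +, 1, Q)`: all sentences in the language `(+, 1, Q)` that are
true in this structure. -/
def theory (Q : Set (ℤ × ℤ × ℤ × ℤ)) : lang.Theory :=
  @Language.completeTheory lang ℤ (intStructure Q)

/-- Gödel numbers of terms in the variables `x_0, …, x_{n-1}`. -/
def termCode {n : ℕ} : lang.Term (Empty ⊕ Fin n) → ℕ
  | .var (.inr i) => Nat.pair 0 i
  | .func .one _ => Nat.pair 1 0
  | .func .add ts => Nat.pair 2 (Nat.pair (termCode (ts 0)) (termCode (ts 1)))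

/-- Gödel numbers of formulas whose free variables are among `x_0, …, x_{n-1}`. In such a formula
the quantifier `all` binds the variable `x_n`. -/
def formulaCode : {n : ℕ} → lang.BoundedFormula Empty n → ℕ
  | _, .falsum => Nat.pair 0 0
  | _, .equal t₁ t₂ => Nat.pair 1 (Nat.pair (termCode t₁) (termCode t₂))
  | _, .rel .quad ts =>
      Nat.pair 2 (Nat.pair (Nat.pair (termCode (ts 0)) (termCode (ts 1)))
        (Nat.pair (termCode (ts 2)) (termCode (ts 3))))
  | _, .imp φ ψ => Nat.pair 3 (Nat.pair (formulaCode φ) (formulaCode ψ))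
  | _, .all φ => Nat.pair 4 (formulaCode φ)

/-- A set of sentences is decidable if the set of Gödel numbers of its members is computable. -/
def IsDecidableTheory (T : lang.Theory) : Prop :=
  ComputablePred fun c : ℕ => ∃ φ : lang.Sentence, φ ∈ T ∧ formulaCode φ = c

/-- Distinct terms have distinct Gödel numbers. -/
theorem termCode_injective {n : ℕ} :
    Function.Injective (termCode : lang.Term (Empty ⊕ Fin n) → ℕ) := by
  intro t
  induction t with
  | var x =>
    intro s h
    rcases x with x | i
    · exact x.elim
    · match s with
      | .var (.inr j) =>
        simp only [termCode, Nat.pair_eq_pair] at h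
        rw [Fin.ext h.2]
      | .func .one _ => simp [termCode] at h
      | .func .add _ => simp [termCode] at h
  | @func k f ts ih =>
    intro s h
    change Func k at f
    cases f with
    | one =>
      match s with
      | .var (.inr j) => simp [termCode] at h
      | .func .add _ => simp [termCode] at h
      | .func .one us => exact congrArg (Language.Term.func _) (funext fun i => i.elim0)
    | add =>
      match s with
      | .var (.inr j) => simp [termCode] at h
      | .func .one _ => simp [termCode] at h
      | .func .add us =>
        simp only [termCode, Nat.pair_eq_pair, true_and] at h
        refine congrArg (Language.Term.func _) (funext fun i => ?_)
        match i with
        | 0 => exact ih 0 h.1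
        | 1 => exact ih 1 h.2

/-- Distinct formulas in the same variables, in particular distinct sentences, have distinct
Gödel numbers. -/
theorem formulaCode_injective {n : ℕ} :
    Function.Injective (formulaCode : lang.BoundedFormula Empty n → ℕ) := by
  intro φ
  induction φ with
  | falsum =>
    intro ψ h
    match ψ with
    | .falsum => rfl
    | .equal _ _ => simp [formulaCode] at h
    | .rel .quad _ => simp [formulaCode] at h
    | .imp _ _ => simp [formulaCode] at h
    | .all _ => simp [formulaCode] at h
  | equal t₁ t₂ =>
    intro ψ h
    match ψ with
    | .falsum => simp [formulaCode] at h
    | .equal _ _ =>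
      simp only [formulaCode, Nat.pair_eq_pair, true_and] at h
      rw [termCode_injective h.1, termCode_injective h.2]
    | .rel .quad _ => simp [formulaCode] at h
    | .imp _ _ => simp [formulaCode] at h
    | .all _ => simp [formulaCode] at h
  | @rel n k R ts =>
    intro ψ h
    change Rel k at R
    cases R
    match ψ with
    | .falsum => simp [formulaCode] at h
    | .equal _ _ => simp [formulaCode] at h
    | .rel .quad us =>
      simp only [formulaCode, Nat.pair_eq_pair, true_and] at h
      refine congrArg (Language.BoundedFormula.rel _) (funext fun i => ?_)
      match i with
      | 0 => exact termCode_injective h.1.1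
      | 1 => exact termCode_injective h.1.2
      | 2 => exact termCode_injective h.2.1
      | 3 => exact termCode_injective h.2.2
    | .imp _ _ => simp [formulaCode] at h
    | .all _ => simp [formulaCode] at h
  | imp φ₁ φ₂ ih₁ ih₂ =>
    intro ψ h
    match ψ with
    | .falsum => simp [formulaCode] at h
    | .equal _ _ => simp [formulaCode] at h
    | .rel .quad _ => simp [formulaCode] at h
    | .imp _ _ =>
      simp only [formulaCode, Nat.pair_eq_pair, true_and] at h
      rw [ih₁ h.1, ih₂ h.2]
    | .all _ => simp [formulaCode] at h
  | all φ ih =>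
    intro ψ h
    match ψ with
    | .falsum => simp [formulaCode] at h
    | .equal _ _ => simp [formulaCode] at h
    | .rel .quad _ => simp [formulaCode] at h
    | .imp _ _ => simp [formulaCode] at h
    | .all _ =>
      simp only [formulaCode, Nat.pair_eq_pair, true_and] at h
      rw [ih h]

end PresburgerQ

/-! When `m ≠ 0`, condition (1) makes `Q` a partial graph of multiplication on the multiples of `m`,
with `m` as unit. Condition (2) supplies, for every `B`, some `m` whose slice of `Q` contains the
multiplication table of `{0, …, B}` (`Table`).

Such tables can be recognised inside the structure. By Lagrange's four-square theorem, sums of four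
scaled squares pick out the nonnegative multiples of `m` up to `B * m`, which defines the segment
from `0` to `B * m`. A first-order condition on `(m, b)` then says that `b = B * m` for some table
of size `B` (`IsTableBound.exists_table`).

An arithmetic predicate is read off inside a table by bounding its quantifiers by the segment
(`IsRep`). The reading is sound in every table containing the arguments, and complete only in large
ones, since witnesses must fit. This asymmetry survives conjunction, disjunction, existential and
bounded universal quantification. With Gödel's beta function these suffice for the graphs of all
primitive recursive functions (`IsRepFun.of_primrec`), hence for the halting predicate. Asserting
that some table confirms halting is a single sentence, computable from the program. -/

namespace PresburgerQ

open FirstOrder FirstOrder.Language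

/-! ### Definable predicates of `(ℤ; +, 1, Q)` -/

/-- The functions `ℤⁿ → ℤ` given by terms. -/
inductive IsTermFun {n : ℕ} : ((Fin n → ℤ) → ℤ) → Prop
  | var (i : Fin n) : IsTermFun fun v => v i
  | one : IsTermFun fun _ => 1
  | add {f g : (Fin n → ℤ) → ℤ} : IsTermFun f → IsTermFun g → IsTermFun fun v => f v + g v

theorem IsTermFun.init {n : ℕ} {f : (Fin n → ℤ) → ℤ} (hf : IsTermFun f) :
    IsTermFun fun v : Fin (n + 1) → ℤ => f (Fin.init v) := by
  induction hf with
  | var i => exact .var i.castSucc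
  | one => exact .one
  | add _ _ h₁ h₂ => exact .add h₁ h₂

theorem IsTermFun.last {n : ℕ} : IsTermFun fun v : Fin (n + 1) → ℤ => v (Fin.last n) :=
  .var _

theorem IsTermFun.exists_term (Q : Set (ℤ × ℤ × ℤ × ℤ)) {n : ℕ} {f : (Fin n → ℤ) → ℤ}
    (hf : IsTermFun f) : ∃ t : lang.Term (Empty ⊕ Fin n), ∀ v : Fin n → ℤ,
      @Term.realize lang ℤ (intStructure Q) _ (Sum.elim default v) t = f v := by
  induction hf with
  | var i => exact ⟨.var (.inr i), fun _ => rfl⟩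
  | one => exact ⟨.func Func.one Fin.elim0, fun _ => rfl⟩
  | add _ _ h₁ h₂ =>
    obtain ⟨s, hs⟩ := h₁
    obtain ⟨t, ht⟩ := h₂
    exact ⟨.func Func.add ![s, t], fun v => congrArg₂ (· + ·) (hs v) (ht v)⟩

/-- The predicates on `ℤⁿ` that are definable in `(ℤ; +, 1, Q)`. -/
def IsDefinable (Q : Set (ℤ × ℤ × ℤ × ℤ)) {n : ℕ} (P : (Fin n → ℤ) → Prop) : Prop :=
  ∃ φ : lang.BoundedFormula Empty n, ∀ v,
    @BoundedFormula.Realize lang ℤ (intStructure Q) _ _ φ default v ↔ P v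

namespace IsDefinable

variable {Q : Set (ℤ × ℤ × ℤ × ℤ)} {n : ℕ}

theorem eq {f g : (Fin n → ℤ) → ℤ} (hf : IsTermFun f) (hg : IsTermFun g) :
    IsDefinable Q fun v => f v = g v := by
  obtain ⟨s, hs⟩ := hf.exists_term Q
  obtain ⟨t, ht⟩ := hg.exists_term Q
  exact ⟨.equal s t, fun v => (congrArg₂ (· = ·) (hs v) (ht v)).to_iff⟩

theorem mem {f₀ f₁ f₂ f₃ : (Fin n → ℤ) → ℤ} (h₀ : IsTermFun f₀) (h₁ : IsTermFun f₁)
    (h₂ : IsTermFun f₂) (h₃ : IsTermFun f₃) :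
    IsDefinable Q fun v => (f₀ v, f₁ v, f₂ v, f₃ v) ∈ Q := by
  obtain ⟨t₀, h₀⟩ := h₀.exists_term Q
  obtain ⟨t₁, h₁⟩ := h₁.exists_term Q
  obtain ⟨t₂, h₂⟩ := h₂.exists_term Q
  obtain ⟨t₃, h₃⟩ := h₃.exists_term Q
  refine ⟨.rel Rel.quad ![t₀, t₁, t₂, t₃], fun v => ?_⟩
  beta_reduce
  rw [← h₀, ← h₁, ← h₂, ← h₃]
  exact Iff.rfl

theorem not {P : (Fin n → ℤ) → Prop} (hP : IsDefinable Q P) : IsDefinable Q fun v => ¬ P v := by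
  obtain ⟨φ, hφ⟩ := hP
  let _ := intStructure Q
  exact ⟨∼φ, fun v => by rw [BoundedFormula.realize_not, hφ]⟩

theorem imp {P R : (Fin n → ℤ) → Prop} (hP : IsDefinable Q P) (hR : IsDefinable Q R) :
    IsDefinable Q fun v => P v → R v := by
  obtain ⟨φ, hφ⟩ := hP
  obtain ⟨ψ, hψ⟩ := hR
  let _ := intStructure Q
  exact ⟨φ.imp ψ, fun v => by rw [BoundedFormula.realize_imp, hφ, hψ]⟩

theorem and {P R : (Fin n → ℤ) → Prop} (hP : IsDefinable Q P) (hR : IsDefinable Q R) :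
    IsDefinable Q fun v => P v ∧ R v := by
  obtain ⟨φ, hφ⟩ := hP
  obtain ⟨ψ, hψ⟩ := hR
  let _ := intStructure Q
  exact ⟨φ ⊓ ψ, fun v => by rw [BoundedFormula.realize_inf, hφ, hψ]⟩

theorem or {P R : (Fin n → ℤ) → Prop} (hP : IsDefinable Q P) (hR : IsDefinable Q R) :
    IsDefinable Q fun v => P v ∨ R v := by
  obtain ⟨φ, hφ⟩ := hP
  obtain ⟨ψ, hψ⟩ := hR
  let _ := intStructure Q
  exact ⟨φ ⊔ ψ, fun v => by rw [BoundedFormula.realize_sup, hφ, hψ]⟩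

theorem all {P : (Fin n → ℤ) → ℤ → Prop}
    (hP : IsDefinable Q fun v : Fin (n + 1) → ℤ => P (Fin.init v) (v (Fin.last n))) :
    IsDefinable Q fun v => ∀ x, P v x := by
  obtain ⟨φ, hφ⟩ := hP
  let _ := intStructure Q
  exact ⟨φ.all, fun v => by simp only [BoundedFormula.realize_all, hφ, Fin.init_snoc, Fin.snoc_last]⟩

theorem ex {P : (Fin n → ℤ) → ℤ → Prop}
    (hP : IsDefinable Q fun v : Fin (n + 1) → ℤ => P (Fin.init v) (v (Fin.last n))) :
    IsDefinable Q fun v => ∃ x, P v x := by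
  obtain ⟨φ, hφ⟩ := hP
  let _ := intStructure Q
  exact ⟨φ.ex, fun v => by simp only [BoundedFormula.realize_ex, hφ, Fin.init_snoc, Fin.snoc_last]⟩

end IsDefinable

/-! ### Finite multiplication tables -/

/-- `Q` contains the multiplication table of `{0, …, B}`, scaled by `m`. -/
structure Table (Q : Set (ℤ × ℤ × ℤ × ℤ)) (m : ℤ) (B : ℕ) : Prop where
  ne_zero : m ≠ 0
  mem : ∀ k l : ℕ, k ≤ B → l ≤ B → (m, k * m, l * m, k * l * m) ∈ Q

/-- Condition (1): the members of `Q` are of the form `(m, km, lm, klm)`. -/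
def IsMulGraph (Q : Set (ℤ × ℤ × ℤ × ℤ)) : Prop :=
  ∀ x ∈ Q, ∃ k l m : ℤ, x = (m, k * m, l * m, k * l * m)

/-- Cancelling `m` recovers both coefficients, so the fourth coordinate is a function of the first
three. -/
theorem IsMulGraph.eq_mul {Q : Set (ℤ × ℤ × ℤ × ℤ)} (hQ : IsMulGraph Q) {m k l z : ℤ}
    (hm : m ≠ 0) (h : (m, k * m, l * m, z) ∈ Q) : z = k * l * m := by
  obtain ⟨k', l', m', h⟩ := hQ _ h
  simp only [Prod.mk.injEq] at h
  obtain ⟨rfl, hk, hl, rfl⟩ := h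
  rw [mul_right_cancel₀ hm hk, mul_right_cancel₀ hm hl]

/-- `s` is of the form `k²m`, as witnessed by `Q`. -/
def IsScaledSq (Q : Set (ℤ × ℤ × ℤ × ℤ)) (m s : ℤ) : Prop :=
  ∃ a, (m, a, a, s) ∈ Q

/-- `x` is of the form `km` with `0 ≤ k`, as witnessed by `Q` through a sum of four squares. -/
def IsScaledNat (Q : Set (ℤ × ℤ × ℤ × ℤ)) (m x : ℤ) : Prop :=
  ∃ s t u w, IsScaledSq Q m s ∧ IsScaledSq Q m t ∧ IsScaledSq Q m u ∧ IsScaledSq Q m w ∧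
    x = s + t + u + w

/-- `x` lies between `0` and `b` in the order on the multiples of `m` in which `m` is positive. -/
def InSegment (Q : Set (ℤ × ℤ × ℤ × ℤ)) (m b x : ℤ) : Prop :=
  ∃ y, x + y = b ∧ IsScaledNat Q m x ∧ IsScaledNat Q m y

/-- The first-order condition saying that `Q` contains the multiplication table of
`{0, …, b / m}`, scaled by `m`. -/
def IsTableBound (Q : Set (ℤ × ℤ × ℤ × ℤ)) (m b : ℤ) : Prop :=
  ¬ m + m = m ∧ (∃ z, z + z = z ∧ InSegment Q m b z) ∧
    (∀ x, InSegment Q m b x → x = b ∨ InSegment Q m b (x + m)) ∧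
    ∀ x y, InSegment Q m b x → InSegment Q m b y → ∃ z, (m, x, y, z) ∈ Q

section

variable {Q : Set (ℤ × ℤ × ℤ × ℤ)} {m : ℤ} {B : ℕ}

/-- Equal middle coordinates force `k = l`, so the coefficient of `m` is a square and thus
nonnegative, whatever the sign of `m`. -/
theorem IsScaledSq.exists_nat (hQ : IsMulGraph Q) (hm : m ≠ 0) {s : ℤ} (h : IsScaledSq Q m s) :
    ∃ k : ℕ, s = k * m := by
  obtain ⟨a, h⟩ := h
  obtain ⟨k, l, m', h⟩ := hQ _ h
  simp only [Prod.mk.injEq] at h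
  obtain ⟨rfl, rfl, hl, rfl⟩ := h
  rw [← mul_right_cancel₀ hm hl]
  exact ⟨(k * k).toNat, by rw [Int.toNat_of_nonneg (mul_self_nonneg k)]⟩

theorem IsScaledNat.exists_nat (hQ : IsMulGraph Q) (hm : m ≠ 0) {x : ℤ}
    (h : IsScaledNat Q m x) : ∃ k : ℕ, x = k * m := by
  obtain ⟨s, t, u, w, hs, ht, hu, hw, rfl⟩ := h
  obtain ⟨a, rfl⟩ := hs.exists_nat hQ hm
  obtain ⟨b, rfl⟩ := ht.exists_nat hQ hm
  obtain ⟨c, rfl⟩ := hu.exists_nat hQ hm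
  obtain ⟨d, rfl⟩ := hw.exists_nat hQ hm
  exact ⟨a + b + c + d, by push_cast; ring⟩

theorem Table.isScaledSq (h : Table Q m B) {k : ℕ} (hk : k ^ 2 ≤ B) :
    IsScaledSq Q m ((k : ℤ) ^ 2 * m) := by
  have hkB : k ≤ B := (Nat.le_self_pow two_ne_zero k).trans hk
  exact ⟨k * m, by simpa only [sq] using h.mem k k hkB hkB⟩

/-- Lagrange's theorem: each of the four squares is at most `k ≤ B`, so the table already witnesses
it. -/
theorem Table.isScaledNat (h : Table Q m B) {k : ℕ} (hk : k ≤ B) : IsScaledNat Q m (k * m) := by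
  obtain ⟨a, b, c, d, rfl⟩ := Nat.sum_four_squares k
  exact ⟨_, _, _, _, h.isScaledSq (k := a) (by omega), h.isScaledSq (k := b) (by omega),
    h.isScaledSq (k := c) (by omega), h.isScaledSq (k := d) (by omega), by push_cast; ring⟩

theorem Table.inSegment_iff (hQ : IsMulGraph Q) (h : Table Q m B) {x : ℤ} :
    InSegment Q m (B * m) x ↔ ∃ k ≤ B, x = (k : ℕ) * m := by
  constructor
  · rintro ⟨y, hxy, hx, hy⟩
    obtain ⟨k, rfl⟩ := hx.exists_nat hQ h.ne_zero
    obtain ⟨l, rfl⟩ := hy.exists_nat hQ h.ne_zero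
    rw [← add_mul] at hxy
    have := mul_right_cancel₀ h.ne_zero hxy
    exact ⟨k, by omega, rfl⟩
  · rintro ⟨k, hk, rfl⟩
    refine ⟨(B - k : ℕ) * m, ?_, h.isScaledNat hk, h.isScaledNat (Nat.sub_le _ _)⟩
    push_cast [hk]
    ring

theorem Table.isTableBound (hQ : IsMulGraph Q) (h : Table Q m B) : IsTableBound Q m (B * m) := by
  refine ⟨by simpa using h.ne_zero, ⟨0, add_zero 0, (h.inSegment_iff hQ).2 ⟨0, by simp⟩⟩,
    fun x hx => ?_, fun x y hx hy => ?_⟩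
  · obtain ⟨k, hk, rfl⟩ := (h.inSegment_iff hQ).1 hx
    rcases hk.eq_or_lt with rfl | hk
    · exact .inl rfl
    · exact .inr ((h.inSegment_iff hQ).2 ⟨k + 1, hk, by push_cast; ring⟩)
  · obtain ⟨k, hk, rfl⟩ := (h.inSegment_iff hQ).1 hx
    obtain ⟨l, hl, rfl⟩ := (h.inSegment_iff hQ).1 hy
    exact ⟨_, h.mem k l hk hl⟩

/-- Starting from `0`, closure under adding `m` can stop only at `b`, so the segment contains every
`k * m` with `k ≤ B`. Products exist on the segment, and `IsMulGraph.eq_mul` forces them to have the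
right value. -/
theorem IsTableBound.exists_table (hQ : IsMulGraph Q) {b : ℤ} (h : IsTableBound Q m b) :
    ∃ B : ℕ, b = B * m ∧ Table Q m B := by
  obtain ⟨hm, ⟨z, hz, h₀⟩, hsucc, hmul⟩ := h
  -- In the absence of a constant for zero, `m + m = m` and `z + z = z` express vanishing.
  replace hm : m ≠ 0 := by simpa using hm
  obtain rfl : z = 0 := by simpa using hz
  obtain ⟨B, rfl⟩ : ∃ B : ℕ, b = B * m := by
    obtain ⟨y, rfl, -, hy⟩ := h₀
    simpa using hy.exists_nat hQ hm
  have hseg : ∀ k : ℕ, k ≤ B → InSegment Q m (B * m) (k * m) := by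
    intro k
    induction k with
    | zero => simpa using h₀
    | succ k ih =>
      intro hk
      rcases hsucc _ (ih (by omega)) with h | h
      · have := mul_right_cancel₀ hm h
        omega
      · simpa [add_mul] using h
  refine ⟨B, rfl, hm, fun k l hk hl => ?_⟩
  obtain ⟨z, hz⟩ := hmul _ _ (hseg k hk) (hseg l hl)
  rwa [← hQ.eq_mul hm hz]

end

/-! ### Definability of the table conditions -/

namespace IsDefinable

variable {Q : Set (ℤ × ℤ × ℤ × ℤ)} {n : ℕ} {m b x : (Fin n → ℤ) → ℤ}

theorem isScaledSq (hm : IsTermFun m) (hx : IsTermFun x) :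
    IsDefinable Q fun v => IsScaledSq Q (m v) (x v) :=
  ex (mem hm.init .last .last hx.init)

theorem isScaledNat (hm : IsTermFun m) (hx : IsTermFun x) :
    IsDefinable Q fun v => IsScaledNat Q (m v) (x v) :=
  have hm' := hm.init.init.init.init
  have hs := IsTermFun.last.init.init.init
  have ht := IsTermFun.last.init.init
  have hu := IsTermFun.last.init
  have hw := IsTermFun.last
  ex (ex (ex (ex ((isScaledSq hm' hs).and ((isScaledSq hm' ht).and ((isScaledSq hm' hu).and
    ((isScaledSq hm' hw).and (eq hx.init.init.init.init (((hs.add ht).add hu).add hw)))))))))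

theorem inSegment (hm : IsTermFun m) (hb : IsTermFun b) (hx : IsTermFun x) :
    IsDefinable Q fun v => InSegment Q (m v) (b v) (x v) :=
  ex ((eq (hx.init.add .last) hb.init).and
    ((isScaledNat hm.init hx.init).and (isScaledNat hm.init .last)))

theorem isTableBound (hm : IsTermFun m) (hb : IsTermFun b) :
    IsDefinable Q fun v => IsTableBound Q (m v) (b v) :=
  (eq (hm.add hm) hm).not.and <|
    (ex ((eq (.add .last .last) .last).and (inSegment hm.init hb.init .last))).and <|
    (all ((inSegment hm.init hb.init .last).imp
      ((eq .last hb.init).or (inSegment hm.init hb.init (.add .last hm.init))))).and <|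
    all <| all <| (inSegment hm.init.init hb.init.init IsTermFun.last.init).imp <|
      (inSegment hm.init.init hb.init.init .last).imp <|
        ex (mem hm.init.init.init IsTermFun.last.init.init IsTermFun.last.init .last)

end IsDefinable

/-! ### Predicates of natural numbers represented by large multiplication tables -/

/-- `P` is represented in `(ℤ; +, 1, Q)`: some relation `D m b x`, definable even after a
substitution of terms, implies `P` in all multiplication tables, and is implied by `P` in all
sufficiently large ones. -/
def IsRep (Q : Set (ℤ × ℤ × ℤ × ℤ)) {n : ℕ} (P : (Fin n → ℕ) → Prop) : Prop :=
  ∃ D : ℤ → ℤ → (Fin n → ℤ) → Prop,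
    (∀ (j : ℕ) (s t : (Fin j → ℤ) → ℤ) (T : Fin n → (Fin j → ℤ) → ℤ), IsTermFun s → IsTermFun t →
      (∀ i, IsTermFun (T i)) → IsDefinable Q fun w => D (s w) (t w) fun i => T i w) ∧
    (∀ (m : ℤ) (B : ℕ) (v : Fin n → ℕ), Table Q m B → (∀ i, v i ≤ B) →
      D m (B * m) (fun i => v i * m) → P v) ∧
    ∀ v, P v → ∃ N, ∀ (m : ℤ) (B : ℕ), Table Q m B → N ≤ B → D m (B * m) fun i => v i * m

theorem snoc_mul {n : ℕ} (v : Fin n → ℕ) (x : ℕ) (m : ℤ) :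
    (fun i => ((Fin.snoc v x : Fin (n + 1) → ℕ) i : ℤ) * m) =
      (Fin.snoc (fun i => v i * m) (x * m) : Fin (n + 1) → ℤ) := by
  funext i
  induction i using Fin.lastCases <;> simp

theorem IsDefinable.snoc {Q : Set (ℤ × ℤ × ℤ × ℤ)} {n j : ℕ} {D : ℤ → ℤ → (Fin (n + 1) → ℤ) → Prop}
    (hD : ∀ (j : ℕ) (s t : (Fin j → ℤ) → ℤ) (T : Fin (n + 1) → (Fin j → ℤ) → ℤ), IsTermFun s →
      IsTermFun t → (∀ i, IsTermFun (T i)) → IsDefinable Q fun w => D (s w) (t w) fun i => T i w)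
    {s t x : (Fin j → ℤ) → ℤ} {T : Fin n → (Fin j → ℤ) → ℤ} (hs : IsTermFun s)
    (ht : IsTermFun t) (hT : ∀ i, IsTermFun (T i)) (hx : IsTermFun x) :
    IsDefinable Q fun w => D (s w) (t w) (Fin.snoc (fun i => T i w) (x w)) := by
  convert hD j s t (Fin.snoc T x : Fin (n + 1) → (Fin j → ℤ) → ℤ) hs ht ?_ using 3 with w
  · funext i
    induction i using Fin.lastCases <;> simp
  · intro i
    induction i using Fin.lastCases <;> simp [hx, hT]

namespace IsRep

variable {Q : Set (ℤ × ℤ × ℤ × ℤ)} {n : ℕ} {P R : (Fin n → ℕ) → Prop}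

theorem of_iff (hP : IsRep Q P) (h : ∀ v, R v ↔ P v) : IsRep Q R := by
  rwa [funext fun v => propext (h v)]

theorem comp (hP : IsRep Q P) {k : ℕ} (σ : Fin n → Fin k) :
    IsRep Q fun v : Fin k → ℕ => P fun i => v (σ i) := by
  obtain ⟨D, h₁, h₂, h₃⟩ := hP
  exact ⟨fun m b v => D m b fun i => v (σ i),
    fun j s t T hs ht hT => h₁ j s t (fun i => T (σ i)) hs ht fun i => hT _,
    fun m B v hB hv => h₂ m B (fun i => v (σ i)) hB fun i => hv _, fun v => h₃ fun i => v (σ i)⟩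

theorem and (hP : IsRep Q P) (hR : IsRep Q R) : IsRep Q fun v => P v ∧ R v := by
  obtain ⟨D, h₁, h₂, h₃⟩ := hP
  obtain ⟨E, h₁', h₂', h₃'⟩ := hR
  refine ⟨fun m b v => D m b v ∧ E m b v,
    fun j s t T hs ht hT => (h₁ j s t T hs ht hT).and (h₁' j s t T hs ht hT),
    fun m B v hB hv h => ⟨h₂ m B v hB hv h.1, h₂' m B v hB hv h.2⟩, fun v h => ?_⟩
  obtain ⟨N, hN⟩ := h₃ v h.1
  obtain ⟨N', hN'⟩ := h₃' v h.2
  exact ⟨max N N', fun m B hB hNB =>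
    ⟨hN m B hB (le_of_max_le_left hNB), hN' m B hB (le_of_max_le_right hNB)⟩⟩

theorem or (hP : IsRep Q P) (hR : IsRep Q R) : IsRep Q fun v => P v ∨ R v := by
  obtain ⟨D, h₁, h₂, h₃⟩ := hP
  obtain ⟨E, h₁', h₂', h₃'⟩ := hR
  refine ⟨fun m b v => D m b v ∨ E m b v,
    fun j s t T hs ht hT => (h₁ j s t T hs ht hT).or (h₁' j s t T hs ht hT),
    fun m B v hB hv h => h.imp (h₂ m B v hB hv) (h₂' m B v hB hv), fun v h => ?_⟩
  rcases h with h | h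
  · obtain ⟨N, hN⟩ := h₃ v h
    exact ⟨N, fun m B hB hNB => .inl (hN m B hB hNB)⟩
  · obtain ⟨N, hN⟩ := h₃' v h
    exact ⟨N, fun m B hB hNB => .inr (hN m B hB hNB)⟩

theorem ex (hQ : IsMulGraph Q) {P : (Fin n → ℕ) → ℕ → Prop}
    (hP : IsRep Q fun v : Fin (n + 1) → ℕ => P (Fin.init v) (v (Fin.last n))) :
    IsRep Q fun v => ∃ x, P v x := by
  obtain ⟨D, h₁, h₂, h₃⟩ := hP
  refine ⟨fun m b v => ∃ x, InSegment Q m b x ∧ D m b (Fin.snoc v x), fun j s t T hs ht hT => ?_,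
    fun m B v hB hv => ?_, fun v => ?_⟩
  · exact .ex ((IsDefinable.inSegment hs.init ht.init .last).and
      (.snoc h₁ hs.init ht.init (fun i => (hT i).init) .last))
  · rintro ⟨x, hx, hD⟩
    obtain ⟨x, hxB, rfl⟩ := (hB.inSegment_iff hQ).1 hx
    rw [← snoc_mul] at hD
    have := h₂ m B _ hB (fun i => ?_) hD
    · exact ⟨x, by simpa using this⟩
    · induction i using Fin.lastCases <;> simp [hxB, hv]
  · rintro ⟨x, hx⟩
    -- The table must be large enough for the matrix and must also contain the witness `x`.
    obtain ⟨N, hN⟩ := h₃ (Fin.snoc v x) (by simpa using hx)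
    refine ⟨max N x, fun m B hB hNB => ⟨x * m,
      (hB.inSegment_iff hQ).2 ⟨x, le_of_max_le_right hNB, rfl⟩, ?_⟩⟩
    rw [← snoc_mul]
    exact hN m B hB (le_of_max_le_left hNB)

theorem add_eq (i j k : Fin n) : IsRep Q fun v => v i + v j = v k := by
  refine ⟨fun _ _ v => v i + v j = v k,
    fun l s t T hs ht hT => .eq ((hT i).add (hT j)) (hT k), fun m B v hB hv h => ?_,
    fun v h => ⟨0, fun m B hB _ => ?_⟩⟩
  · beta_reduce at h
    rw [← add_mul] at h
    exact_mod_cast mul_right_cancel₀ hB.ne_zero h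
  · simp [← h, add_mul]

theorem mul_eq (hQ : IsMulGraph Q) (i j k : Fin n) : IsRep Q fun v => v i * v j = v k := by
  refine ⟨fun m _ v => (m, v i, v j, v k) ∈ Q,
    fun l s t T hs ht hT => .mem hs (hT i) (hT j) (hT k), fun m B v hB hv h => ?_,
    fun v h => ⟨max (v i) (v j), fun m B hB hN => ?_⟩⟩
  · exact_mod_cast (mul_right_cancel₀ hB.ne_zero (hQ.eq_mul hB.ne_zero h)).symm
  · beta_reduce
    rw [← h]
    simpa using hB.mem _ _ (le_of_max_le_left hN) (le_of_max_le_right hN)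

theorem one_eq (i : Fin n) : IsRep Q fun v => 1 = v i := by
  refine ⟨fun m _ v => m = v i, fun l s t T hs ht hT => .eq hs (hT i),
    fun m B v hB hv h => ?_, fun v h => ⟨0, fun m B hB _ => by simp [← h]⟩⟩
  have : (1 : ℤ) * m = v i * m := by rwa [one_mul]
  exact_mod_cast mul_right_cancel₀ hB.ne_zero this

/-- The strict bound is expressed additively, as `x + y + 1 = v i` scaled by `m`. Only finitely many
`x` are concerned, so their completeness thresholds have a common upper bound. -/
theorem forall_lt (hQ : IsMulGraph Q) {P : (Fin n → ℕ) → ℕ → Prop} (i : Fin n)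
    (hP : IsRep Q fun v : Fin (n + 1) → ℕ => P (Fin.init v) (v (Fin.last n))) :
    IsRep Q fun v => ∀ x < v i, P v x := by
  obtain ⟨D, h₁, h₂, h₃⟩ := hP
  refine ⟨fun m b v => ∀ x y, InSegment Q m b x → InSegment Q m b y → x + y + m = v i →
    D m b (Fin.snoc v x), fun j s t T hs ht hT => ?_, fun m B v hB hv h x hx => ?_, fun v h => ?_⟩
  · have hs' := hs.init.init
    have ht' := ht.init.init
    have hx := IsTermFun.last (n := j).init
    exact .all (.all ((IsDefinable.inSegment hs' ht' hx).imp
      ((IsDefinable.inSegment hs' ht' .last).imp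
        ((IsDefinable.eq ((hx.add .last).add hs') (hT i).init.init).imp
          (.snoc h₁ hs' ht' (fun i => (hT i).init.init) hx)))))
  · have hvi := hv i
    have hD := h (x * m) ((v i - x - 1 : ℕ) * m)
      ((hB.inSegment_iff hQ).2 ⟨x, by omega, rfl⟩)
      ((hB.inSegment_iff hQ).2 ⟨_, by omega, rfl⟩) (by
        have : (v i : ℤ) = x + (v i - x - 1 : ℕ) + 1 := by omega
        beta_reduce
        rw [this]
        ring)
    rw [← snoc_mul] at hD
    have := h₂ m B _ hB (fun i => ?_) hD
    · simpa using this
    · induction i using Fin.lastCases with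
      | last => simp; omega
      | cast i => simpa using hv i
  · have : ∀ x : Fin (v i), ∃ N, ∀ (m : ℤ) (B : ℕ), Table Q m B → N ≤ B →
        D m (B * m) fun i => (Fin.snoc v x : Fin (n + 1) → ℕ) i * m :=
      fun x => h₃ _ (by simpa using h x x.2)
    choose N hN using this
    refine ⟨Finset.univ.sup N, fun m B hB hNB x y hx hy hxy => ?_⟩
    obtain ⟨x, -, rfl⟩ := (hB.inSegment_iff hQ).1 hx
    obtain ⟨y, -, rfl⟩ := (hB.inSegment_iff hQ).1 hy
    have hlt : x + y + 1 = v i := by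
      have : ((x + y + 1 : ℕ) : ℤ) * m = v i * m := by
        push_cast
        linear_combination hxy
      exact_mod_cast mul_right_cancel₀ hB.ne_zero this
    rw [← snoc_mul]
    exact hN ⟨x, by omega⟩ m B hB ((Finset.le_sup (Finset.mem_univ _)).trans hNB)

end IsRep

/-- The function `f` is represented in `(ℤ; +, 1, Q)` through its graph. -/
def IsRepFun (Q : Set (ℤ × ℤ × ℤ × ℤ)) {n : ℕ} (f : (Fin n → ℕ) → ℕ) : Prop :=
  IsRep Q fun v : Fin (n + 1) → ℕ => f (Fin.init v) = v (Fin.last n)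

/-! ### Represented functions, up to the primitive recursive ones -/

section

variable {Q : Set (ℤ × ℤ × ℤ × ℤ)} {n : ℕ} {f g : (Fin n → ℕ) → ℕ}

theorem IsRepFun.comp (hf : IsRepFun Q f) {k : ℕ} (σ : Fin n → Fin k) :
    IsRepFun Q fun v : Fin k → ℕ => f fun i => v (σ i) := by
  refine (IsRep.comp hf (Fin.snoc (fun i => (σ i).castSucc) (Fin.last k))).of_iff fun v => ?_
  simp [Fin.init_def]

theorem IsRepFun.init (hf : IsRepFun Q f) :
    IsRepFun Q fun v : Fin (n + 1) → ℕ => f (Fin.init v) :=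
  hf.comp Fin.castSucc

/-- A value is substituted by quantifying over it: `∃ x, f v = x ∧ P v x`. -/
theorem IsRep.subst (hQ : IsMulGraph Q) (hf : IsRepFun Q f) {P : (Fin n → ℕ) → ℕ → Prop}
    (hP : IsRep Q fun v : Fin (n + 1) → ℕ => P (Fin.init v) (v (Fin.last n))) :
    IsRep Q fun v => P v (f v) :=
  (IsRep.ex hQ (P := fun v x => f v = x ∧ P v x) (hf.and hP)).of_iff fun v => by simp

theorem IsRepFun.subst (hQ : IsMulGraph Q) (hf : IsRepFun Q f) {h : (Fin n → ℕ) → ℕ → ℕ}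
    (hh : IsRepFun Q fun v : Fin (n + 1) → ℕ => h (Fin.init v) (v (Fin.last n))) :
    IsRepFun Q fun v => h v (f v) :=
  IsRep.subst hQ hf.init (P := fun v x => h (Fin.init v) x = v (Fin.last n)) <| by
    -- The last two variables, the output and the substituted value, are interchanged.
    refine (IsRep.comp hh (Fin.snoc (Fin.snoc (fun i => i.castSucc.castSucc)
      (Fin.last (n + 1))) (Fin.last n).castSucc)).of_iff fun v => ?_
    simp [Fin.init_def]

theorem IsRep.subst₂ (hQ : IsMulGraph Q) {P : ℕ → ℕ → Prop}
    (hP : ∀ {n : ℕ} (i j : Fin n), IsRep Q fun v => P (v i) (v j))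
    (hf : IsRepFun Q f) (hg : IsRepFun Q g) : IsRep Q fun v => P (f v) (g v) :=
  .subst hQ hf (P := fun v x => P x (g v)) <|
    .subst hQ hg.init (P := fun v y => P (v (Fin.last n)) y) <|
      hP (Fin.last n).castSucc (Fin.last (n + 1))

theorem IsRepFun.subst₂ (hQ : IsMulGraph Q) {h : ℕ → ℕ → ℕ}
    (hh : ∀ {n : ℕ} (i j : Fin n), IsRepFun Q fun v => h (v i) (v j))
    (hf : IsRepFun Q f) (hg : IsRepFun Q g) : IsRepFun Q fun v => h (f v) (g v) :=
  .subst hQ hf (h := fun v x => h x (g v)) <|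
    .subst hQ hg.init (h := fun v y => h (v (Fin.last n)) y) <|
      hh (Fin.last n).castSucc (Fin.last (n + 1))

theorem IsRep.eq_var (i j : Fin n) : IsRep Q fun v => v i = v j := by
  refine ⟨fun _ _ v => v i = v j, fun l s t T hs ht hT => .eq (hT i) (hT j),
    fun m B v hB hv h => ?_, fun v h => ⟨0, fun m B hB _ => by simp [h]⟩⟩
  exact_mod_cast mul_right_cancel₀ hB.ne_zero h

theorem IsRepFun.var (i : Fin n) : IsRepFun Q fun v => v i :=
  IsRep.eq_var i.castSucc (Fin.last n)

theorem IsRepFun.last : IsRepFun Q fun v : Fin (n + 1) → ℕ => v (Fin.last n) :=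
  .var _

theorem IsRepFun.one : IsRepFun Q fun _ : Fin n → ℕ => 1 :=
  IsRep.one_eq _

theorem IsRepFun.zero : IsRepFun Q fun _ : Fin n → ℕ => 0 :=
  (IsRep.add_eq (Fin.last n) (Fin.last n) (Fin.last n)).of_iff fun v => by simp [eq_comm]

variable (hQ : IsMulGraph Q)
include hQ

theorem IsRep.eq (hf : IsRepFun Q f) (hg : IsRepFun Q g) : IsRep Q fun v => f v = g v :=
  .subst₂ hQ .eq_var hf hg

theorem IsRepFun.add (hf : IsRepFun Q f) (hg : IsRepFun Q g) : IsRepFun Q fun v => f v + g v :=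
  .subst₂ hQ (h := (· + ·)) (fun _ _ => IsRep.add_eq _ _ _) hf hg

theorem IsRepFun.mul (hf : IsRepFun Q f) (hg : IsRepFun Q g) : IsRepFun Q fun v => f v * g v :=
  .subst₂ hQ (h := (· * ·)) (fun _ _ => IsRep.mul_eq hQ _ _ _) hf hg

theorem IsRep.le (hf : IsRepFun Q f) (hg : IsRepFun Q g) : IsRep Q fun v => f v ≤ g v :=
  (IsRep.ex hQ (P := fun v x => f v + x = g v) <|
    IsRep.eq hQ (.add hQ hf.init .last) hg.init).of_iff fun v => by
      simp only [le_iff_exists_add, eq_comm]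

theorem IsRep.lt (hf : IsRepFun Q f) (hg : IsRepFun Q g) : IsRep Q fun v => f v < g v :=
  IsRep.le hQ (hf.add hQ .one) hg

theorem IsRepFun.pair (hf : IsRepFun Q f) (hg : IsRepFun Q g) :
    IsRepFun Q fun v => Nat.pair (f v) (g v) := by
  refine ((((IsRep.lt hQ hf.init hg.init).and (IsRep.eq hQ
    ((hg.init.mul hQ hg.init).add hQ hf.init) .last))).or ((IsRep.le hQ hg.init hf.init).and (IsRep.eq hQ
      (((hf.init.mul hQ hf.init).add hQ hf.init).add hQ hg.init) .last))).of_iff fun v => ?_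
  simp only [Nat.pair]
  split <;> grind

theorem IsRepFun.unpair_fst (hf : IsRepFun Q f) : IsRepFun Q fun v => (f v).unpair.1 :=
  (IsRep.ex hQ (P := fun v x => f (Fin.init v) = Nat.pair (v (Fin.last n)) x) <|
    IsRep.eq hQ hf.init.init (IsRepFun.last.init.pair hQ .last)).of_iff fun v => by
      constructor
      · intro h
        exact ⟨(f (Fin.init v)).unpair.2, by rw [← h, Nat.pair_unpair]⟩
      · rintro ⟨x, hx⟩
        simp [hx]

theorem IsRepFun.unpair_snd (hf : IsRepFun Q f) : IsRepFun Q fun v => (f v).unpair.2 :=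
  (IsRep.ex hQ (P := fun v x => f (Fin.init v) = Nat.pair x (v (Fin.last n))) <|
    IsRep.eq hQ hf.init.init (IsRepFun.last.pair hQ IsRepFun.last.init)).of_iff fun v => by
      constructor
      · intro h
        exact ⟨(f (Fin.init v)).unpair.1, by rw [← h, Nat.pair_unpair]⟩
      · rintro ⟨x, hx⟩
        simp [hx]

theorem IsRepFun.mod_add_one (hf : IsRepFun Q f) (hg : IsRepFun Q g) :
    IsRepFun Q fun v => f v % (g v + 1) :=
  ((IsRep.lt hQ .last (hg.init.add hQ .one)).and <| IsRep.ex hQ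
    (P := fun v x => v (Fin.last n) + (g (Fin.init v) + 1) * x = f (Fin.init v)) <|
    IsRep.eq hQ (IsRepFun.last.init.add hQ ((hg.init.init.add hQ .one).mul hQ .last))
      hf.init.init).of_iff fun v => by
      constructor
      · rintro h
        rw [← h]
        exact ⟨Nat.mod_lt _ (Nat.succ_pos _), _, Nat.mod_add_div _ _⟩
      · rintro ⟨h, x, hx⟩
        simp [← hx, Nat.mod_eq_of_lt h]

theorem IsRepFun.beta (hf : IsRepFun Q f) (hg : IsRepFun Q g) :
    IsRepFun Q fun v => Nat.beta (f v) (g v) :=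
  .mod_add_one hQ (hf.unpair_fst hQ) ((hg.add hQ .one).mul hQ (hf.unpair_snd hQ))

/-- Gödel's device: the value is the last entry of a finite sequence, coded by one number `s`
through `Nat.beta`, that starts at `c` and obeys the recursion at each step. Checking the steps
needs only a bounded universal quantifier. -/
theorem IsRepFun.rec {c d : ℕ → ℕ}
    (hc : ∀ {n : ℕ} {f : (Fin n → ℕ) → ℕ}, IsRepFun Q f → IsRepFun Q fun v => c (f v))
    (hd : ∀ {n : ℕ} {f : (Fin n → ℕ) → ℕ}, IsRepFun Q f → IsRepFun Q fun v => d (f v))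
    (i j : Fin n) : IsRepFun Q fun v =>
      (v j).rec (c (v i)) fun y IH => d (Nat.pair (v i) (Nat.pair y IH)) := by
  have hi : IsRepFun Q fun v : Fin (n + 2) → ℕ => v i.castSucc.castSucc := .var _
  have hj : IsRepFun Q fun v : Fin (n + 2) → ℕ => v j.castSucc.castSucc := .var _
  have hi' := hi.init
  have hs := IsRepFun.last (Q := Q) (n := n + 1)
  refine (IsRep.ex hQ (P := fun (v : Fin (n + 1) → ℕ) s => Nat.beta s 0 = c (v i.castSucc) ∧
    (∀ y < v j.castSucc, Nat.beta s (y + 1) =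
      d (Nat.pair (v i.castSucc) (Nat.pair y (Nat.beta s y)))) ∧
    Nat.beta s (v j.castSucc) = v (Fin.last n)) <|
    (IsRep.eq hQ (hs.beta hQ .zero) (hc hi)).and <| IsRep.and (IsRep.forall_lt hQ _ <|
      IsRep.eq hQ (hs.init.beta hQ (IsRepFun.last.add hQ .one))
        (hd (hi'.pair hQ (IsRepFun.last.pair hQ (hs.init.beta hQ .last))))) <|
      IsRep.eq hQ (hs.beta hQ hj) IsRepFun.last.init).of_iff fun v => ?_
  set F : ℕ → ℕ := fun k =>
    k.rec (c (v i.castSucc)) fun y IH => d (Nat.pair (v i.castSucc) (Nat.pair y IH)) with hF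
  change F (v j.castSucc) = _ ↔ _
  constructor
  · intro h
    have hb : ∀ y ≤ v j.castSucc,
        Nat.beta (Nat.unbeta (List.ofFn fun y : Fin (v j.castSucc + 1) => F y)) y = F y := by
      intro y hy
      have := Nat.beta_unbeta_coe (List.ofFn fun y : Fin (v j.castSucc + 1) => F y)
        ⟨y, by simpa using Nat.lt_succ_of_le hy⟩
      rwa [Fin.getElem_fin, List.getElem_ofFn] at this
    refine ⟨_, hb 0 (Nat.zero_le _), fun y hy => ?_, (hb _ le_rfl).trans h⟩
    rw [hb _ hy, hb _ hy.le]
  · rintro ⟨s, h₀, hs, h⟩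
    rw [← h]
    have hb : ∀ y ≤ v j.castSucc, Nat.beta s y = F y := by
      intro y
      induction y with
      | zero => exact fun _ => h₀
      | succ y ih =>
        intro hy
        rw [hs y hy, ih (Nat.le_of_succ_le hy)]
    exact (hb _ le_rfl).symm

theorem IsRepFun.of_primrec {h : ℕ → ℕ} (hh : Nat.Primrec h) :
    ∀ {n : ℕ} {f : (Fin n → ℕ) → ℕ}, IsRepFun Q f → IsRepFun Q fun v => h (f v) := by
  induction hh with
  | zero => exact fun _ => .zero
  | succ => exact fun hf => hf.add hQ .one
  | left => exact fun hf => hf.unpair_fst hQ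
  | right => exact fun hf => hf.unpair_snd hQ
  | pair _ _ h₁ h₂ => exact fun hf => (h₁ hf).pair hQ (h₂ hf)
  | comp _ _ h₁ h₂ => exact fun hf => h₁ (h₂ hf)
  | @prec c d _ _ h₁ h₂ =>
    exact fun hf => .subst₂ hQ
      (h := fun z n => n.rec (c z) fun y IH => d (Nat.pair z (Nat.pair y IH)))
      (IsRepFun.rec hQ h₁ h₂) (hf.unpair_fst hQ) (hf.unpair_snd hQ)

end

/-! ### Reduction of the halting problem -/

/-- A represented unary predicate is expressed by a formula in the variables `m` and `x`. -/
theorem IsRep.exists_formula {Q : Set (ℤ × ℤ × ℤ × ℤ)} (hQ : IsMulGraph Q)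
    (hQ' : ∀ B : ℕ, ∃ m, Table Q m B) {P : ℕ → Prop}
    (hP : IsRep Q fun v : Fin 1 → ℕ => P (v 0)) :
    ∃ φ : lang.BoundedFormula Empty 2, ∀ n : ℕ,
      P n ↔ ∃ m : ℤ, @BoundedFormula.Realize lang ℤ (intStructure Q) _ _ φ default ![m, n * m] := by
  obtain ⟨D, h₁, h₂, h₃⟩ := hP
  obtain ⟨φ, hφ⟩ : IsDefinable Q fun w : Fin 2 → ℤ => ∃ b, IsTableBound Q (w 0) b ∧
      InSegment Q (w 0) b (w 1) ∧ D (w 0) b fun _ => w 1 := by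
    have hm : IsTermFun fun w : Fin 3 → ℤ => w 0 := .var 0
    have hx : IsTermFun fun w : Fin 3 → ℤ => w 1 := .var 1
    exact .ex ((IsDefinable.isTableBound hm .last).and
      ((IsDefinable.inSegment hm .last hx).and (h₁ _ _ _ _ hm .last fun _ => hx)))
  refine ⟨φ, fun n => ?_⟩
  simp only [hφ, Matrix.cons_val_zero, Matrix.cons_val_one]
  constructor
  · intro hn
    obtain ⟨N, hN⟩ := h₃ (fun _ => n) hn
    obtain ⟨m, hm⟩ := hQ' (max N n)
    exact ⟨m, _, hm.isTableBound hQ, (hm.inSegment_iff hQ).2 ⟨n, le_max_right _ _, rfl⟩,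
      hN m _ hm (le_max_left _ _)⟩
  · rintro ⟨m, b, hb, hn, hD⟩
    obtain ⟨B, rfl, hB⟩ := hb.exists_table hQ
    obtain ⟨k, hk, hkn⟩ := (hB.inSegment_iff hQ).1 hn
    obtain rfl : n = k := by exact_mod_cast mul_right_cancel₀ hB.ne_zero hkn
    exact h₂ m B (fun _ => n) hB (fun _ => hk) hD

/-- The term `(n + 1) m`, where `m` is the variable `x_0`. -/
def succMulTerm : ℕ → lang.Term (Empty ⊕ Fin 2)
  | 0 => .var (.inr 0)
  | n + 1 => .func Func.add ![succMulTerm n, .var (.inr 0)]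

theorem realize_succMulTerm (Q : Set (ℤ × ℤ × ℤ × ℤ)) (n : ℕ) (v : Fin 2 → ℤ) :
    @Term.realize lang ℤ (intStructure Q) _ (Sum.elim default v) (succMulTerm n) =
      (n + 1) * v 0 := by
  induction n with
  | zero => simp [succMulTerm]
  | succ n ih =>
    rw [Nat.cast_succ, add_mul, ← ih, one_mul]
    rfl

theorem primrec_termCode_succMulTerm : Primrec fun n => termCode (succMulTerm n) := by
  have h : Primrec₂ fun (_ c : ℕ) => Nat.pair 2 (Nat.pair c (Nat.pair 0 0)) :=
    Primrec₂.natPair.comp (.const 2) (Primrec₂.natPair.comp .snd (.const _))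
  refine (Primrec.nat_rec₁ (Nat.pair 0 0) h).of_eq fun n => ?_
  induction n with
  | zero => rfl
  | succ n ih => exact congrArg (fun c => Nat.pair 2 (Nat.pair c (Nat.pair 0 0))) ih

/-- The sentence `∃ m x, x + m = (n + 1) m ∧ φ(m, x)`. -/
def instanceSentence (φ : lang.BoundedFormula Empty 2) (n : ℕ) : lang.Sentence :=
  (BoundedFormula.equal (.func Func.add ![.var (.inr 1), .var (.inr 0)]) (succMulTerm n) ⊓ φ).ex.ex

/-- Adding `m` to both sides of `x = n * m` covers `n = 0` without a term for zero; cancelling `m`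
undoes it. -/
theorem instanceSentence_mem_theory_iff (Q : Set (ℤ × ℤ × ℤ × ℤ))
    (φ : lang.BoundedFormula Empty 2) (n : ℕ) : instanceSentence φ n ∈ theory Q ↔
      ∃ m : ℤ, @BoundedFormula.Realize lang ℤ (intStructure Q) _ _ φ default ![m, n * m] := by
  let _ := intStructure Q
  have hv (m x : ℤ) : Fin.snoc (α := fun _ => ℤ) (Fin.snoc (α := fun _ => ℤ)
      (default : Fin 0 → ℤ) m) x = ![m, x] := by
    funext i
    fin_cases i <;> rfl
  have heq (m x : ℤ) : (BoundedFormula.equal (.func Func.add ![.var (.inr 1), .var (.inr 0)])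
      (succMulTerm n) : lang.BoundedFormula Empty 2).Realize default ![m, x] ↔ x = n * m := by
    change x + m = Term.realize (Sum.elim default ![m, x]) (succMulTerm n) ↔ _
    rw [realize_succMulTerm, Matrix.cons_val_zero, add_mul, one_mul, add_left_inj]
  have key (e : Empty → ℤ) : BoundedFormula.Realize (instanceSentence φ n) e default ↔
      ∃ m : ℤ, φ.Realize default ![m, n * m] := by
    rw [Subsingleton.elim e default]
    simp only [instanceSentence, BoundedFormula.realize_ex, BoundedFormula.realize_inf, hv, heq,
      exists_eq_left]
  exact key _

theorem primrec_formulaCode_instanceSentence (φ : lang.BoundedFormula Empty 2) :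
    Primrec fun n => formulaCode (instanceSentence φ n) := by
  have himp {f g : ℕ → ℕ} (hf : Primrec f) (hg : Primrec g) :
      Primrec fun n => Nat.pair 3 (Nat.pair (f n) (g n)) :=
    Primrec₂.natPair.comp (.const 3) (Primrec₂.natPair.comp hf hg)
  have hnot {f : ℕ → ℕ} (hf : Primrec f) :
      Primrec fun n => Nat.pair 3 (Nat.pair (f n) (Nat.pair 0 0)) := himp hf (.const _)
  have hall {f : ℕ → ℕ} (hf : Primrec f) : Primrec fun n => Nat.pair 4 (f n) :=
    Primrec₂.natPair.comp (.const 4) hf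
  have heq : Primrec fun n => Nat.pair 1 (Nat.pair
      (Nat.pair 2 (Nat.pair (Nat.pair 0 1) (Nat.pair 0 0))) (termCode (succMulTerm n))) :=
    Primrec₂.natPair.comp (.const 1)
      (Primrec₂.natPair.comp (.const _) primrec_termCode_succMulTerm)
  -- The nesting follows the unfolding of `∃` as `¬∀¬` and of `φ ⊓ ψ` as `¬(φ → ¬ψ)`.
  exact hnot (hall (hnot (hnot (hall (hnot (hnot (himp heq (hnot (.const (formulaCode φ))))))))))

theorem not_isDecidableTheory_theory {Q : Set (ℤ × ℤ × ℤ × ℤ)} (hQ : IsMulGraph Q)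
    (hQ' : ∀ B : ℕ, ∃ m, Table Q m B) : ¬ IsDecidableTheory (theory Q) := by
  open Nat.Partrec in
  intro hdec
  let p : ℕ → Prop := fun n => ((Denumerable.ofNat Code n).eval 0).Dom
  -- Evaluation of a program on input `0` with bounded resources: the encoding is `0` for `none` and
  -- positive for `some`, so halting becomes `∃ k, 0 < f (Nat.pair n k)` with `f` primitive
  -- recursive.
  let f : ℕ → ℕ := fun n => Encodable.encode
    (Code.evaln n.unpair.2 (Denumerable.ofNat Code n.unpair.1) 0)
  have hf : Nat.Primrec f := by
    refine Primrec.nat_iff.1 (Primrec.encode.comp (Code.primrec_evaln.comp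
      (.pair (.pair ?_ ?_) (.const 0))))
    · exact Primrec.snd.comp Primrec.unpair
    · exact (Primrec.ofNat Code).comp (Primrec.fst.comp Primrec.unpair)
  have hp (n : ℕ) : p n ↔ ∃ k, 0 < f (Nat.pair n k) := by
    have (o : Option ℕ) : 0 < Encodable.encode o ↔ ∃ x, x ∈ o := by cases o <;> simp
    simp only [p, f, Part.dom_iff_mem, Code.evaln_complete, Nat.unpair_pair, this]
    exact exists_comm
  have hrep : IsRep Q fun v : Fin 1 → ℕ => p (v 0) := by
    simp only [hp]
    exact .ex hQ (IsRep.lt hQ .zero (.of_primrec hQ hf (.pair hQ (.var 0) .last)))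
  obtain ⟨φ, hφ⟩ := hrep.exists_formula hQ hQ'
  refine ComputablePred.halting_problem 0 (ComputablePred.computable_of_manyOneReducible
    ⟨fun c => formulaCode (instanceSentence φ (Encodable.encode c)),
      (primrec_formulaCode_instanceSentence φ).to_comp.comp Computable.encode, fun c => ?_⟩ hdec)
  have hc := hφ (Encodable.encode c)
  rw [← instanceSentence_mem_theory_iff] at hc
  simp only [p, Denumerable.ofNat_encode] at hc
  refine hc.trans ?_
  constructor
  · exact fun h => ⟨_, h, rfl⟩
  · rintro ⟨ψ, hψ, h⟩
    -- Injectivity of the Gödel numbering identifies the true sentence `ψ` with the instance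
    -- sentence.
    rwa [← formulaCode_injective h]

end PresburgerQ

theorem mainTheorem4 (Q : Set (ℤ × ℤ × ℤ × ℤ))
    (hQ₁ : ∀ x ∈ Q, ∃ k l m : ℤ, x = (m, k * m, l * m, k * l * m))
    (hQ₂ : ∀ F : Finset (ℤ × ℤ), ∃ m : ℤ, m ≠ 0 ∧
      ∀ k l : ℤ, (k, l) ∈ F → (m, k * m, l * m, k * l * m) ∈ Q) :
    ¬ PresburgerQ.IsDecidableTheory (PresburgerQ.theory Q) := by
  refine PresburgerQ.not_isDecidableTheory_theory hQ₁ fun B => ?_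
  obtain ⟨m, hm, h⟩ := hQ₂ (Finset.Icc 0 (B : ℤ) ×ˢ Finset.Icc 0 (B : ℤ))
  exact ⟨m, hm, fun k l hk hl => h k l (by simp [hk, hl])⟩
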